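/- Let $K$ be an arbitrary field and let $p(s)=s^n+a_{n-1}s^{n-1}+\dots+a_0\in K[s]$ be monic and irreducible. Let $k\ge 0$ be an integer, let $h\in K[s]^q$ and $g\in K[s]^t$ be polynomial column vectors, and assume that $$W=h\,\frac1{p^k}\,g^T\in K(s)^{q\times t}$$ is a coprime factorization, i.e. $h$ and the $1\times1$ matrix $p^k$ have only unimodular common right divisors, and $p^k$ and $g^T$ have only unimodular common left divisors. Let $C=C(p)\in K^{n\times n}$ be the companion matrix with ones on the superdiagonal, last row $(-a_0,\dots,-a_{n-1})$ and zeros elsewhere. Let $V=e_ne_1^T\in K^{n\times n}$, and let $J(p^k)\in K^{nk\times nk}$ be the block upper bidiagonal matrix with $k$ diagonal blocks $C$ and all superdiagonal blocks equal to $V$ (the Jacobson block). Let $M=M(p)\in K^{n\times n}$ be the invertible Hankel matrix with entries $M_{ij}=a_{i+j-1}$ for $1\le i,j\le n$, where $a_n=1$ and $a_m=0$ for $m>n$. Put $b(s)=(1,s,\dots,s^{n-1})^T$. Let $h=\sum_{i\ge0}h_ip^i$ and $g=\sum_{i\ge0}g_ip^i$ be the $p$-adic expansions, where $h_i\in K[s]^q$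 and $g_i\in K[s]^t$ have entries of degree less than $n$. Define $H_i\in K^{q\times n}$ and $G_i\in K^{t\times n}$ by $$h_i(s)=H_i\,b(s),\qquad g_i(s)=G_i\,M\,b(s),$$ and set $$H=(H_0,\dots,H_{k-1}),\qquad G=\begin{pmatrix}G_{k-1}^T\\ \vdots\\ G_0^T\end{pmatrix}.$$ Let $\pi_-$ denote the entrywise strictly proper part: every $f\in K(s)$ is uniquely $f=\pi_-f+y$ with $\pi_-f$ strictly proper and $y\in K[s]$. Then $$\pi_-W=H\bigl(sI-J(p^k)\bigr)^{-1}G,$$ and this realization is minimal: if $\pi_-W=H'(sI-F')^{-1}G'$ with $F'\in K^{m\times m}$, $G'\in K^{m\times t}$, $H'\in K^{q\times m}$, then $m\ge nk$. (For $k=0$ the matrices $H$, $J$, $G$ are empty and both sides are $0$.) -/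

import Mathlib

open Polynomial
open scoped Matrix

namespace JacobsonRealization

noncomputable section

variable {K : Type*} [Field K]

/-! ### Strictly proper rational functions and the projection onto them -/

/-- A rational function is strictly proper if it is `0` or a quotient `a / b` of nonzero
polynomials with `deg a < deg b`. -/
def IsStrictlyProper (f : RatFunc K) : Prop :=
  f = 0 ∨ ∃ a b : K[X], a * b ≠ 0 ∧ a.natDegree < b.natDegree ∧
    f = algebraMap K[X] (RatFunc K) a / algebraMap K[X] (RatFunc K) b

/-- The strictly proper part `π₋ f`: the remainder of the numerator modulo the denominator, over
the denominator. It is characterized by `piMinus_spec` and `piMinus_unique`. -/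
def piMinus (f : RatFunc K) : RatFunc K :=
  algebraMap K[X] (RatFunc K) (f.num %ₘ f.denom) / algebraMap K[X] (RatFunc K) f.denom

theorem piMinus_spec (f : RatFunc K) :
    IsStrictlyProper (piMinus f) ∧
      ∃ y : K[X], f = piMinus f + algebraMap K[X] (RatFunc K) y := by
  have hd := f.denom_ne_zero
  have hd' : algebraMap K[X] (RatFunc K) f.denom ≠ 0 := RatFunc.algebraMap_ne_zero hd
  constructor
  · by_cases h0 : f.num %ₘ f.denom = 0
    · left
      simp [piMinus, h0]
    · right
      exact ⟨_, _, mul_ne_zero h0 hd,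
        natDegree_lt_natDegree h0 (degree_modByMonic_lt _ f.monic_denom), rfl⟩
  · refine ⟨f.num /ₘ f.denom, ?_⟩
    conv_lhs => rw [← RatFunc.num_div_denom f, ← modByMonic_add_div f.num f.denom]
    rw [map_add, map_mul, piMinus]
    field_simp

theorem piMinus_unique (f w : RatFunc K) (y : K[X]) (hw : IsStrictlyProper w)
    (h : f = w + algebraMap K[X] (RatFunc K) y) : w = piMinus f := by
  obtain ⟨hp, z, hz⟩ := piMinus_spec f
  have key : ∀ u : RatFunc K, IsStrictlyProper u → ∃ a b : K[X], b ≠ 0 ∧ a.degree < b.degree ∧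
      u = algebraMap K[X] (RatFunc K) a / algebraMap K[X] (RatFunc K) b := by
    rintro u (rfl | ⟨a, b, hab, hlt, rfl⟩)
    · exact ⟨0, 1, one_ne_zero, by simp, by simp⟩
    · exact ⟨a, b, right_ne_zero_of_mul hab, degree_lt_degree hlt, rfl⟩
  obtain ⟨a, b, hb, hab, hwe⟩ := key w hw
  obtain ⟨c, d, hd, hcd, hpe⟩ := key _ hp
  have hb' : algebraMap K[X] (RatFunc K) b ≠ 0 := RatFunc.algebraMap_ne_zero hb
  have hd' : algebraMap K[X] (RatFunc K) d ≠ 0 := RatFunc.algebraMap_ne_zero hd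
  have e : a * d - c * b = (z - y) * (b * d) := by
    apply RatFunc.algebraMap_injective K
    have e1 := h.symm.trans hz
    rw [hwe, hpe] at e1
    simp only [map_sub, map_mul]
    field_simp at e1
    linear_combination e1
  have hlt : (a * d - c * b).degree < (b * d).degree := by
    refine (degree_sub_le _ _).trans_lt (max_lt ?_ ?_)
    · rw [degree_mul, degree_mul]
      exact WithBot.add_lt_add_right (by simpa using hd) hab
    · rw [degree_mul, degree_mul, add_comm]
      exact WithBot.add_lt_add_left (by simpa using hb) hcd
  have hzy : z - y = 0 := by
    by_contra hne
    rw [e, degree_mul (p := z - y)] at hlt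
    have h1 : (0 : WithBot ℕ) ≤ (z - y).degree := zero_le_degree_iff.2 hne
    exact absurd hlt (not_lt.2 (le_add_of_nonneg_left h1))
  have hzy' : z = y := sub_eq_zero.1 hzy
  subst hzy'
  exact add_right_cancel (h.symm.trans hz)

/-! ### Coprime factorizations of matrices of rational functions -/

/-- `P` and `A` are right coprime: every common right divisor is unimodular. -/
def IsRightCoprime {q r : Type*} [Fintype r] [DecidableEq r]
    (P : Matrix q r K[X]) (A : Matrix r r K[X]) : Prop :=
  ∀ (D A' : Matrix r r K[X]) (P' : Matrix q r K[X]), P = P' * D → A = A' * D → IsUnit D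

/-- `A` and `S` are left coprime: every common left divisor is unimodular. -/
def IsLeftCoprime {r t : Type*} [Fintype r] [DecidableEq r]
    (A : Matrix r r K[X]) (S : Matrix r t K[X]) : Prop :=
  ∀ (D A' : Matrix r r K[X]) (S' : Matrix r t K[X]), A = D * A' → S = D * S' → IsUnit D

/-- `W = P A⁻¹ S` is a coprime factorization. -/
structure IsCoprimeFactorization {q r t : Type*} [Fintype r] [DecidableEq r]
    (W : Matrix q t (RatFunc K)) (P : Matrix q r K[X]) (A : Matrix r r K[X])
    (S : Matrix r t K[X]) : Prop where
  det_ne_zero : A.det ≠ 0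
  eq : W = P.map (algebraMap K[X] (RatFunc K)) * (A.map (algebraMap K[X] (RatFunc K)))⁻¹ *
    S.map (algebraMap K[X] (RatFunc K))
  right_coprime : IsRightCoprime P A
  left_coprime : IsLeftCoprime A S

/-! ### State space realizations -/

/-- The transfer matrix `H (sI - F)⁻¹ G`. -/
def transferMatrix {q t ι : Type*} [Fintype ι] [DecidableEq ι]
    (H : Matrix q ι K) (F : Matrix ι ι K) (G : Matrix ι t K) : Matrix q t (RatFunc K) :=
  H.map RatFunc.C * ((RatFunc.X : RatFunc K) • (1 : Matrix ι ι (RatFunc K)) - F.map RatFunc.C)⁻¹ *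
    G.map RatFunc.C

/-- `(H, F, G)` is a realization of `T`. -/
def IsRealization {q t ι : Type*} [Fintype ι] [DecidableEq ι] (T : Matrix q t (RatFunc K))
    (H : Matrix q ι K) (F : Matrix ι ι K) (G : Matrix ι t K) : Prop :=
  T = transferMatrix H F G

/-- `(H, F, G)` is a minimal realization of `T`: no realization has a smaller dimension. -/
def IsMinimalRealization {q t ι : Type*} [Fintype ι] [DecidableEq ι] (T : Matrix q t (RatFunc K))
    (H : Matrix q ι K) (F : Matrix ι ι K) (G : Matrix ι t K) : Prop :=
  IsRealization T H F G ∧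
    ∀ (m : ℕ) (H' : Matrix q (Fin m) K) (F' : Matrix (Fin m) (Fin m) K) (G' : Matrix (Fin m) t K),
      IsRealization T H' F' G' → Fintype.card ι ≤ m

/-! ### The matrices `C(p)`, `V`, `J(pᵏ)` and `M(p)` -/

/-- The companion matrix `C(p)`: ones on the superdiagonal, last row `(-a₀, …, -aₙ₋₁)`. -/
def companion (p : K[X]) : Matrix (Fin p.natDegree) (Fin p.natDegree) K :=
  Matrix.of fun i j =>
    if (i : ℕ) + 1 = p.natDegree then -p.coeff j else if (i : ℕ) + 1 = j then 1 else 0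

/-- The `n × n` matrix `V = eₙ e₁ᵀ`. -/
def cornerMatrix (n : ℕ) : Matrix (Fin n) (Fin n) K :=
  Matrix.of fun i j => if (i : ℕ) + 1 = n ∧ (j : ℕ) = 0 then 1 else 0

/-- The Jacobson block `J(pᵏ)`, with `k` diagonal blocks `C(p)` and superdiagonal blocks `V`.
The index `(a, i)` stands for position `i` in block `a`. -/
def jacobsonBlock (p : K[X]) (k : ℕ) :
    Matrix (Fin k × Fin p.natDegree) (Fin k × Fin p.natDegree) K :=
  Matrix.of fun x y =>
    if x.1 = y.1 then companion p x.2 y.2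
    else if (x.1 : ℕ) + 1 = y.1 then cornerMatrix p.natDegree x.2 y.2
    else 0

/-- The Hankel matrix `M(p) = (aᵢ₊ⱼ₊₁)` for `0 ≤ i, j < n`, where `aₙ = 1` and `aₘ = 0` for
`m > n`, as `p` is monic. -/
def hankelM (p : K[X]) : Matrix (Fin p.natDegree) (Fin p.natDegree) K :=
  Matrix.of fun i j => p.coeff ((i : ℕ) + j + 1)

theorem isUnit_hankelM {p : K[X]} (hp : p.Monic) : IsUnit (hankelM p) := by
  rw [← Matrix.isUnit_submatrix_equiv (Equiv.refl _) Fin.revPerm, Matrix.isUnit_iff_isUnit_det,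
    Matrix.det_of_isUpperTriangular]
  · have : ∀ i, ((hankelM p).submatrix (Equiv.refl _) Fin.revPerm) i i = 1 := by
      intro i
      have hi : (i : ℕ) + (p.natDegree - (i + 1)) + 1 = p.natDegree := by omega
      simp only [hankelM, Matrix.submatrix_apply, Matrix.of_apply, Fin.revPerm_apply,
        Equiv.refl_apply, Fin.val_rev, hi]
      exact hp
    rw [Finset.prod_congr rfl fun i _ => this i, Finset.prod_const_one]
    exact isUnit_one
  · intro i j hij
    have hij' : (j : ℕ) < i := hij
    simp only [hankelM, Matrix.submatrix_apply, Matrix.of_apply, Fin.revPerm_apply,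
      Equiv.refl_apply, Fin.val_rev]
    exact coeff_eq_zero_of_natDegree_lt (by omega)

/-! ### The `p`-adic expansion and the matrices `H` and `G` -/

/-- The `i`-th coefficient `fᵢ` of the `p`-adic expansion `f = f₀ + f₁ p + f₂ p² + ⋯`,
`deg fᵢ < deg p`, obtained by repeated division by the monic polynomial `p`. -/
def padicCoeff (p f : K[X]) (i : ℕ) : K[X] :=
  ((fun u => u /ₘ p)^[i] f) %ₘ p

theorem degree_padicCoeff_lt {p : K[X]} (hp : p.Monic) (f : K[X]) (i : ℕ) :
    (padicCoeff p f i).degree < p.degree :=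
  degree_modByMonic_lt _ hp

theorem sum_padicCoeff (p f : K[X]) (m : ℕ) :
    f = (∑ i ∈ Finset.range m, padicCoeff p f i * p ^ i) + ((fun u => u /ₘ p)^[m] f) * p ^ m := by
  induction m with
  | zero => simp
  | succ m ih =>
    rw [Finset.sum_range_succ, Function.iterate_succ_apply']
    have := modByMonic_add_div ((fun u => u /ₘ p)^[m] f) p
    conv_lhs => rw [ih, ← this]
    rw [padicCoeff]
    ring

theorem sum_padicCoeff_eq {p : K[X]} (hp : p.Monic) (hn : 0 < p.natDegree) (f : K[X]) (m : ℕ)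
    (hm : f.natDegree < m) : f = ∑ i ∈ Finset.range m, padicCoeff p f i * p ^ i := by
  have hdeg : ∀ j, ((fun u => u /ₘ p)^[j] f).natDegree = f.natDegree - j * p.natDegree := by
    intro j
    induction j with
    | zero => simp
    | succ j ih =>
      rw [Function.iterate_succ_apply', natDegree_divByMonic _ hp, ih, Nat.sub_sub, Nat.succ_mul]
  obtain ⟨j, rfl⟩ : ∃ j, m = j + 1 := ⟨m - 1, by omega⟩
  have h0 : (fun u => u /ₘ p)^[j + 1] f = 0 := by
    rw [Function.iterate_succ_apply', divByMonic_eq_zero_iff hp]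
    refine degree_lt_degree ?_
    rw [hdeg]
    have : j ≤ j * p.natDegree := Nat.le_mul_of_pos_right j hn
    omega
  conv_lhs => rw [sum_padicCoeff p f (j + 1), h0, zero_mul, add_zero]

/-- The polynomial column vector `b(s) = (1, s, …, sⁿ⁻¹)ᵀ`. -/
def powerVector (n : ℕ) : Fin n → K[X] := fun j => X ^ (j : ℕ)

/-- The constant matrix `Hᵢ` with `hᵢ(s) = Hᵢ b(s)`, where `hᵢ` is the `i`-th `p`-adic
coefficient of the polynomial vector `h`. -/
def padicMatrix {q : Type*} (p : K[X]) (h : q → K[X]) (i : ℕ) : Matrix q (Fin p.natDegree) K :=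
  Matrix.of fun a j => (padicCoeff p (h a) i).coeff j

theorem padicMatrix_mulVec {q : Type*} {p : K[X]} (hp : p.Monic) (h : q → K[X]) (i : ℕ) :
    (padicMatrix p h i).map C *ᵥ powerVector p.natDegree = fun a => padicCoeff p (h a) i := by
  funext a
  have hlt : (padicCoeff p (h a) i).degree < (p.natDegree : WithBot ℕ) := by
    rw [← degree_eq_natDegree hp.ne_zero]
    exact degree_padicCoeff_lt hp _ _
  simp only [Matrix.mulVec, dotProduct, Matrix.map_apply, padicMatrix, Matrix.of_apply,
    powerVector]
  rw [Fin.sum_univ_eq_sum_range (fun j => C ((padicCoeff p (h a) i).coeff j) * X ^ j)]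
  rcases Nat.eq_zero_or_pos p.natDegree with h0 | h0
  · rw [h0] at hlt ⊢
    have : padicCoeff p (h a) i = 0 := by
      rw [← degree_eq_bot]
      exact Nat.WithBot.lt_zero_iff.1 hlt
    simp [this]
  · refine (as_sum_range_C_mul_X_pow' _ ?_).symm
    by_cases hz : padicCoeff p (h a) i = 0
    · simpa [hz] using h0
    · exact (natDegree_lt_iff_degree_lt hz).2 hlt

/-- The constant matrix `Gᵢ` with `gᵢ(s) = Gᵢ M(p) b(s)`, where `gᵢ` is the `i`-th `p`-adic
coefficient of the polynomial vector `g`. -/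
def padicMatrixM {t : Type*} (p : K[X]) (g : t → K[X]) (i : ℕ) : Matrix t (Fin p.natDegree) K :=
  padicMatrix p g i * (hankelM p)⁻¹

theorem padicMatrixM_mulVec {t : Type*} {p : K[X]} (hp : p.Monic) (g : t → K[X]) (i : ℕ) :
    (padicMatrixM p g i * hankelM p).map C *ᵥ powerVector p.natDegree =
      fun a => padicCoeff p (g a) i := by
  rw [padicMatrixM, Matrix.mul_assoc,
    Matrix.nonsing_inv_mul _ ((Matrix.isUnit_iff_isUnit_det _).1 (isUnit_hankelM hp)),
    Matrix.mul_one, padicMatrix_mulVec hp]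

/-- The block row `H = (H₀, …, Hₖ₋₁)`. -/
def outputMatrix {q : Type*} (p : K[X]) (k : ℕ) (h : q → K[X]) :
    Matrix q (Fin k × Fin p.natDegree) K :=
  Matrix.of fun a x => padicMatrix p h x.1 a x.2

/-- The block column `G` with blocks `Gₖ₋₁ᵀ, …, G₀ᵀ` from top to bottom. -/
def inputMatrix {t : Type*} (p : K[X]) (k : ℕ) (g : t → K[X]) :
    Matrix (Fin k × Fin p.natDegree) t K :=
  Matrix.of fun x b => (padicMatrixM p g (k - 1 - x.1)).transpose x.2 b

end

end JacobsonRealization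

open JacobsonRealization

namespace JacobsonRealization

variable {K : Type*} [Field K]

/-! ### Strictly proper rational functions -/

/-! The resolvent of the Jacobson block is explicit. With `horner p y` the `y`-th entry of `M b`,
its entry at position `(x, y)` of block `(i, c)` is the strictly proper part of `s ^ x * horner p y
/ p ^ (c - i + 1)` when `i ≤ c`, and zero below the block diagonal (`resolventEntry`,
`mul_resolvent`).

Modulo polynomials this entry is `(s ^ x * p ^ i) * (horner p y * p ^ (k - 1 - c)) / p ^ k`, so the
whole resolvent is congruent to a rank one matrix over `p ^ k` (`resolvent_sub_mem_range`).
Multiplying by `H` on the left and `G` on the right reassembles the `p`-adic expansions of `h` and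
`g` modulo `p ^ k`, so the transfer matrix differs from `h gᵀ / p ^ k` by polynomials. It is also
strictly proper, and uniqueness of the strictly proper part gives equality
(`piMinus_eq_transferMatrix`).

For minimality, coprimality yields entries of `h` and `g` prime to `p`. The characteristic
polynomial of any realization clears the denominator of the corresponding entry of `π₋ W`, so it is
divisible by `p ^ k`; its degree is the dimension (`natDegree_pow_le_of_isRealization`). -/

theorem isStrictlyProper_div {a b : K[X]} (h : a.degree < b.degree) :
    IsStrictlyProper (algebraMap K[X] (RatFunc K) a / algebraMap K[X] (RatFunc K) b) := by
  by_cases ha : a = 0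
  · left; simp [ha]
  · have hb : b ≠ 0 := ne_zero_of_degree_gt h
    exact Or.inr ⟨a, b, mul_ne_zero ha hb, natDegree_lt_natDegree ha h, rfl⟩

theorem IsStrictlyProper.exists_div {f : RatFunc K} (hf : IsStrictlyProper f) :
    ∃ a b : K[X], b ≠ 0 ∧ a.degree < b.degree ∧
      f = algebraMap K[X] (RatFunc K) a / algebraMap K[X] (RatFunc K) b := by
  rcases hf with rfl | ⟨a, b, hab, hlt, rfl⟩
  · exact ⟨0, 1, one_ne_zero, by simp, by simp⟩
  · exact ⟨a, b, right_ne_zero_of_mul hab, degree_lt_degree hlt, rfl⟩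

theorem IsStrictlyProper.add {f g : RatFunc K} (hf : IsStrictlyProper f)
    (hg : IsStrictlyProper g) : IsStrictlyProper (f + g) := by
  obtain ⟨a, b, hb, hab, rfl⟩ := hf.exists_div
  obtain ⟨c, d, hd, hcd, rfl⟩ := hg.exists_div
  rw [div_add_div _ _ (RatFunc.algebraMap_ne_zero hb) (RatFunc.algebraMap_ne_zero hd), ← map_mul,
    ← map_mul, ← map_mul, ← map_add]
  refine isStrictlyProper_div ((degree_add_le _ _).trans_lt (max_lt ?_ ?_))
  · rw [degree_mul, degree_mul]
    exact WithBot.add_lt_add_right (by simpa using hd) hab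
  · rw [degree_mul, degree_mul]
    exact WithBot.add_lt_add_left (by simpa using hb) hcd

theorem IsStrictlyProper.C_mul {f : RatFunc K} (c : K) (hf : IsStrictlyProper f) :
    IsStrictlyProper (RatFunc.C c * f) := by
  obtain ⟨a, b, hb, hab, rfl⟩ := hf.exists_div
  rw [← RatFunc.algebraMap_C, ← mul_div_assoc, ← map_mul]
  refine isStrictlyProper_div (lt_of_le_of_lt ?_ hab)
  rw [← smul_eq_C_mul]
  exact degree_smul_le c a

theorem isStrictlyProper_sum {ι : Type*} (s : Finset ι) (f : ι → RatFunc K)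
    (hf : ∀ i ∈ s, IsStrictlyProper (f i)) : IsStrictlyProper (∑ i ∈ s, f i) :=
  Finset.sum_induction f IsStrictlyProper (fun _ _ => IsStrictlyProper.add) (Or.inl rfl) hf

/-! ### The Horner polynomials of `p` -/

/-- The `y`-th entry of `M(p) b(s)`, which is the polynomial part of `p / s ^ (y + 1)`. -/
noncomputable def horner (p : K[X]) (y : ℕ) : K[X] :=
  ∑ l ∈ Finset.range p.natDegree, C (p.coeff (l + y + 1)) * X ^ l

theorem horner_eq_sum (p : K[X]) (y : ℕ) :
    horner p y = ∑ l ∈ Finset.range (p.natDegree - y), C (p.coeff (l + y + 1)) * X ^ l := by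
  refine (Finset.sum_subset (Finset.range_mono (Nat.sub_le _ _)) fun l _ hl => ?_).symm
  rw [Finset.mem_range, not_lt] at hl
  rw [coeff_eq_zero_of_natDegree_lt (by omega), C_0, zero_mul]

theorem degree_horner_lt (p : K[X]) (y : ℕ) :
    (horner p y).degree < ((p.natDegree - y : ℕ) : WithBot ℕ) := by
  rw [horner_eq_sum]
  refine (degree_sum_le _ _).trans_lt ((Finset.sup_lt_iff (WithBot.bot_lt_coe _)).2 fun l hl => ?_)
  exact (degree_C_mul_X_pow_le _ _).trans_lt (by exact_mod_cast Finset.mem_range.1 hl)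

theorem X_pow_mul_horner (p : K[X]) {y : ℕ} (hy : y < p.natDegree) :
    p = X ^ (y + 1) * horner p y + ∑ j ∈ Finset.range (y + 1), C (p.coeff j) * X ^ j := by
  conv_lhs => rw [p.as_sum_range_C_mul_X_pow]
  have e : p.natDegree + 1 = (y + 1) + (p.natDegree - y) := by omega
  rw [e, Finset.sum_range_add, horner_eq_sum, Finset.mul_sum, add_comm]
  congr 1
  refine Finset.sum_congr rfl fun l _ => ?_
  rw [show y + 1 + l = l + y + 1 by ring]
  ring

/-- The polynomial part of `s ^ x * horner p y / p`. -/
noncomputable def hornerQuot (x y : ℕ) : K[X] := if y < x then X ^ (x - 1 - y) else 0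

/-- Multiplication by `s` preserves the polynomial part except when a new constant term appears,
which happens exactly at `x = y`. These jumps become the ones of the identity matrix in
`mul_resolvent`. -/
theorem X_mul_hornerQuot (x y : ℕ) :
    X * hornerQuot x y = hornerQuot (x + 1) y - if x = y then (1 : K[X]) else 0 := by
  unfold hornerQuot
  rcases lt_trichotomy y x with h | h | h
  · rw [if_pos h, if_pos (by omega), if_neg (by omega), ← pow_succ', sub_zero]
    congr 1; omega
  · subst h; simp
  · rw [if_neg (by omega), if_neg (by omega), if_neg (by omega)]; simp

/-- Replacing `s ^ x` by `p` in `s ^ x * horner p y / p` leaves the polynomial `horner p y`; this is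
the same replacement made on polynomial parts. -/
theorem sum_coeff_mul_hornerQuot {p : K[X]} (y : ℕ) (hy : y < p.natDegree) :
    ∑ j ∈ Finset.range (p.natDegree + 1), C (p.coeff j) * hornerQuot j y = horner p y := by
  have e : p.natDegree + 1 = (y + 1) + (p.natDegree - y) := by omega
  rw [e, Finset.sum_range_add, horner_eq_sum, Finset.sum_eq_zero, zero_add]
  · refine Finset.sum_congr rfl fun l _ => ?_
    rw [hornerQuot, if_pos (by omega), show y + 1 + l - 1 - y = l by omega,
      show y + 1 + l = l + y + 1 by ring]
  · intro j hj
    rw [Finset.mem_range] at hj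
    rw [hornerQuot, if_neg (by omega), mul_zero]

theorem degree_horner_remainder_lt {p : K[X]} {x y : ℕ} (hx : x < p.natDegree)
    (hy : y < p.natDegree) :
    (X ^ x * horner p y - hornerQuot x y * p).degree < p.degree := by
  have hp0 : p ≠ 0 := by rintro rfl; simp at hx
  rw [degree_eq_natDegree hp0]
  rcases lt_or_ge y x with h | h
  · rw [hornerQuot, if_pos h]
    -- Only the terms of `p` of degree at most `y` survive; shifted by `x - 1 - y` they have degree
    -- at most `x - 1`.
    have e : X ^ x * horner p y - X ^ (x - 1 - y) * p =
        -(∑ j ∈ Finset.range (y + 1), C (p.coeff j) * X ^ j) * X ^ (x - 1 - y) := by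
      have h1 : (X : K[X]) ^ x = X ^ (x - 1 - y) * X ^ (y + 1) := by
        rw [← pow_add]; congr 1; omega
      rw [h1]
      linear_combination (-X ^ (x - 1 - y)) * X_pow_mul_horner p hy
    rw [e, degree_mul, degree_neg, degree_X_pow]
    have h2 : (∑ j ∈ Finset.range (y + 1), C (p.coeff j) * X ^ j).degree ≤ (y : WithBot ℕ) := by
      refine (degree_sum_le _ _).trans (Finset.sup_le fun l hl => ?_)
      refine (degree_C_mul_X_pow_le _ _).trans ?_
      rw [Finset.mem_range] at hl
      exact_mod_cast (by omega : l ≤ y)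
    refine (add_le_add_left h2 _).trans_lt ?_
    exact_mod_cast (by omega : y + (x - 1 - y) < p.natDegree)
  · rw [hornerQuot, if_neg (by omega), zero_mul, sub_zero, degree_mul, degree_X_pow]
    refine (WithBot.add_lt_add_left (WithBot.natCast_ne_bot x) (degree_horner_lt p y)).trans_le ?_
    exact_mod_cast (by omega : x + (p.natDegree - y) ≤ p.natDegree)

/-! ### The resolvent of the Jacobson block -/

/-- The entry at position `(x, y)` of block `(i, c)` of `(sI - J(pᵏ))⁻¹`, which does not depend
on `k`. -/
noncomputable def resolventEntry (p : K[X]) (i c x y : ℕ) : RatFunc K :=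
  if c < i then 0 else
    algebraMap K[X] (RatFunc K) (X ^ x * horner p y) /
        algebraMap K[X] (RatFunc K) p ^ (c - i + 1) -
      if i = c then algebraMap K[X] (RatFunc K) (hornerQuot x y) else 0

/-- On the diagonal blocks the subtracted `hornerQuot` is the quotient by `p`. Above them nothing
need be subtracted: the numerator has degree below `2n`, while the denominator is at least `p ^ 2`.
-/
theorem isStrictlyProper_resolventEntry {p : K[X]} {i c x y : ℕ} (hx : x < p.natDegree)
    (hy : y < p.natDegree) : IsStrictlyProper (resolventEntry p i c x y) := by
  have hp0 : p ≠ 0 := by rintro rfl; simp at hx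
  have hp' : algebraMap K[X] (RatFunc K) p ≠ 0 := RatFunc.algebraMap_ne_zero hp0
  unfold resolventEntry
  rcases lt_trichotomy c i with h | h | h
  · rw [if_pos h]; exact Or.inl rfl
  · subst h
    have := isStrictlyProper_div (degree_horner_remainder_lt hx hy)
    rw [if_neg (lt_irrefl _), if_pos rfl, Nat.sub_self, zero_add, pow_one]
    convert this using 1
    rw [map_sub, map_mul _ (hornerQuot x y)]
    field_simp
  · rw [if_neg (by omega), if_neg (by omega), sub_zero, ← map_pow]
    apply isStrictlyProper_div
    rw [degree_mul, degree_X_pow, degree_pow, degree_eq_natDegree hp0]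
    refine (WithBot.add_lt_add_left (WithBot.natCast_ne_bot x) (degree_horner_lt p y)).trans_le ?_
    rw [nsmul_eq_mul]
    have : p.natDegree + p.natDegree ≤ (c - i + 1) * p.natDegree := by
      rw [← two_mul]; exact Nat.mul_le_mul_right _ (by omega)
    exact_mod_cast (by omega : x + (p.natDegree - y) ≤ (c - i + 1) * p.natDegree)

/-- This is the row relation of `sI - J` for the superdiagonal ones. It also holds at `x + 1 = n`,
outside the index range of a block, which the last rows need. -/
theorem X_mul_resolventEntry {p : K[X]} (i c x y : ℕ) :
    RatFunc.X * resolventEntry p i c x y =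
      resolventEntry p i c (x + 1) y + if i = c ∧ x = y then 1 else 0 := by
  have hq := congrArg (algebraMap K[X] (RatFunc K)) (X_mul_hornerQuot (K := K) x y)
  rw [map_mul, RatFunc.algebraMap_X, map_sub, apply_ite (algebraMap K[X] (RatFunc K)), map_one,
    map_zero] at hq
  unfold resolventEntry
  rcases lt_trichotomy c i with h | h | h
  · simp [h, h.ne']
  · subst h
    simp only [lt_irrefl, if_false, if_true, true_and, pow_succ X x, map_mul, RatFunc.algebraMap_X]
    linear_combination -hq
  · simp only [h.not_gt, h.ne, if_false, false_and, pow_succ X x, map_mul, RatFunc.algebraMap_X]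
    ring

/-- Combining the entries with the coefficients of `p` multiplies by `p`, which cancels one factor
of the denominator and so moves to the next block row. That is the coupling encoded by `V`; for `i =
c` the result is `horner p y - horner p y = 0`. -/
theorem sum_coeff_mul_resolventEntry {p : K[X]} {y : ℕ} (hy : y < p.natDegree) (i c : ℕ) :
    ∑ j ∈ Finset.range (p.natDegree + 1), RatFunc.C (p.coeff j) * resolventEntry p i c j y =
      resolventEntry p (i + 1) c 0 y := by
  have hp0 : p ≠ 0 := by rintro rfl; simp at hy
  have hp' : algebraMap K[X] (RatFunc K) p ≠ 0 := RatFunc.algebraMap_ne_zero hp0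
  have h1 : ∑ j ∈ Finset.range (p.natDegree + 1), RatFunc.C (p.coeff j) *
      algebraMap K[X] (RatFunc K) (X ^ j * horner p y) =
      algebraMap K[X] (RatFunc K) p * algebraMap K[X] (RatFunc K) (horner p y) := by
    conv_rhs => enter [1]; rw [p.as_sum_range_C_mul_X_pow]
    rw [map_sum, Finset.sum_mul]
    refine Finset.sum_congr rfl fun j _ => ?_
    rw [map_mul, map_mul, RatFunc.algebraMap_C, mul_assoc]
  have h2 := congrArg (algebraMap K[X] (RatFunc K)) (sum_coeff_mul_hornerQuot y hy)
  rw [map_sum] at h2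
  simp only [map_mul _ (C _), RatFunc.algebraMap_C] at h2
  unfold resolventEntry
  rcases lt_trichotomy c i with h | h | h
  · simp [h, h.trans (Nat.lt_succ_self i)]
  · subst h
    simp only [lt_irrefl, if_false, if_true, Nat.lt_succ_self, Nat.sub_self, zero_add, pow_one,
      mul_sub, Finset.sum_sub_distrib, h2, ← mul_div_assoc, ← Finset.sum_div, h1]
    field_simp
    simp
  · simp only [h.not_gt, h.ne, if_false, sub_zero, ← mul_div_assoc, ← Finset.sum_div, h1,
      pow_zero, one_mul, (show ¬ c < i + 1 by omega)]
    rw [show c - i + 1 = (c - (i + 1) + 1) + 1 by omega, pow_succ' _ (c - (i + 1) + 1),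
      mul_div_mul_left _ _ hp']
    simp [hornerQuot]

/-- Multiplication by the Jacobson block, for a vector given by a function on `ℕ × ℕ`. -/
theorem jacobsonBlock_map_mulVec (p : K[X]) (k : ℕ) (f : ℕ → ℕ → RatFunc K)
    (hf : ∀ x, f k x = 0) (z : Fin k × Fin p.natDegree) :
    ∑ w : Fin k × Fin p.natDegree, RatFunc.C (jacobsonBlock p k z w) * f w.1 w.2 =
      if (z.2 : ℕ) + 1 = p.natDegree then
        f (z.1 + 1) 0 - ∑ j ∈ Finset.range p.natDegree, RatFunc.C (p.coeff j) * f z.1 j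
      else f z.1 (z.2 + 1) := by
  obtain ⟨i, x⟩ := z
  have hsplit : ∀ w : Fin k × Fin p.natDegree, RatFunc.C (jacobsonBlock p k (i, x) w) * f w.1 w.2 =
      (if i = w.1 then RatFunc.C (companion p x w.2) * f w.1 w.2 else 0) +
      (if (i : ℕ) + 1 = w.1 then RatFunc.C (cornerMatrix p.natDegree x w.2) * f w.1 w.2
        else 0) := by
    rintro ⟨j, w⟩
    simp only [jacobsonBlock, Matrix.of_apply]
    by_cases h : i = j
    · subst h; simp
    · by_cases h' : (i : ℕ) + 1 = j <;> simp [h, h']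
  have hn : 0 < p.natDegree := x.pos
  rw [Finset.sum_congr rfl fun w _ => hsplit w, Finset.sum_add_distrib, Fintype.sum_prod_type,
    Fintype.sum_prod_type]
  have e1 : ∑ j : Fin k, ∑ w : Fin p.natDegree,
      (if i = j then RatFunc.C (companion p x w) * f j w else 0) =
      ∑ w : Fin p.natDegree, RatFunc.C (companion p x w) * f i w := by
    rw [Finset.sum_comm]
    simp
  have e2 : ∑ j : Fin k, ∑ w : Fin p.natDegree,
      (if (i : ℕ) + 1 = j then RatFunc.C (cornerMatrix p.natDegree x w) * f j w else 0) =
      if (x : ℕ) + 1 = p.natDegree then f (i + 1) 0 else 0 := by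
    have e3 : ∀ j : Fin k, ∑ w : Fin p.natDegree,
        (if (i : ℕ) + 1 = j then RatFunc.C (cornerMatrix p.natDegree x w) * f j w else 0) =
        if (i : ℕ) + 1 = j then (if (x : ℕ) + 1 = p.natDegree then f (i + 1) 0 else 0) else 0 := by
      intro j
      by_cases hj : (i : ℕ) + 1 = j
      · simp only [hj, if_true]
        rw [Finset.sum_eq_single ⟨0, hn⟩]
        · by_cases hx : (x : ℕ) + 1 = p.natDegree <;> simp [cornerMatrix, hx]
        · intro w _ hw
          have : (w : ℕ) ≠ 0 := fun h => hw (Fin.ext h)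
          simp [cornerMatrix, this]
        · simp
      · simp [hj]
    rw [Finset.sum_congr rfl fun j _ => e3 j]
    by_cases hik : (i : ℕ) + 1 < k
    · rw [Finset.sum_eq_single ⟨i + 1, hik⟩]
      · simp
      · intro j _ hj
        exact if_neg fun h => hj (Fin.ext h.symm)
      · simp
    · have : (i : ℕ) + 1 = k := by omega
      rw [this, hf, ite_self]
      simp
  rw [e1, e2]
  by_cases hx : (x : ℕ) + 1 = p.natDegree
  · simp only [hx, if_true, companion, Matrix.of_apply, map_neg, neg_mul, Finset.sum_neg_distrib]
    rw [Fin.sum_univ_eq_sum_range (fun j => RatFunc.C (p.coeff j) * f i j)]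
    ring
  · have hx' : (x : ℕ) + 1 < p.natDegree := by omega
    simp only [hx, if_false, companion, Matrix.of_apply, add_zero]
    rw [Finset.sum_eq_single ⟨x + 1, hx'⟩]
    · simp
    · intro w _ hw
      rw [if_neg fun h => hw (Fin.ext h.symm), map_zero, zero_mul]
    · simp

/-- The matrix `(sI - J(pᵏ))⁻¹`. -/
noncomputable def resolvent (p : K[X]) (k : ℕ) :
    Matrix (Fin k × Fin p.natDegree) (Fin k × Fin p.natDegree) (RatFunc K) :=
  Matrix.of fun z w => resolventEntry p z.1 w.1 z.2 w.2

theorem mul_resolvent {p : K[X]} (hp : p.Monic) (k : ℕ) :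
    ((RatFunc.X : RatFunc K) • (1 : Matrix (Fin k × Fin p.natDegree) (Fin k × Fin p.natDegree)
      (RatFunc K)) - (jacobsonBlock p k).map RatFunc.C) * resolvent p k = 1 := by
  ext z w
  rw [Matrix.sub_mul, Matrix.smul_mul, Matrix.one_mul, Matrix.sub_apply, Matrix.smul_apply,
    Matrix.mul_apply]
  simp only [Matrix.map_apply, resolvent, Matrix.of_apply, smul_eq_mul]
  rw [jacobsonBlock_map_mulVec p k (fun i x => resolventEntry p i w.1 x w.2)
    (fun x => by simp [resolventEntry]), X_mul_resolventEntry]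
  have h1 : (1 : Matrix (Fin k × Fin p.natDegree) (Fin k × Fin p.natDegree) (RatFunc K)) z w =
      if (z.1 : ℕ) = w.1 ∧ (z.2 : ℕ) = w.2 then 1 else 0 := by
    simp only [Matrix.one_apply, Prod.ext_iff, Fin.ext_iff]
  rw [h1]
  by_cases hz : (z.2 : ℕ) + 1 = p.natDegree
  -- In the last row of a block the shift produces the out-of-range entry `x = n`. Since `aₙ = 1`,
  -- this relation expresses it through the companion row and the first entry of the next block.
  · have h2 := sum_coeff_mul_resolventEntry w.2.2 z.1 w.1
    rw [Finset.sum_range_succ, hp.coeff_natDegree, map_one, one_mul] at h2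
    rw [if_pos hz, hz, ← h2]
    ring
  · rw [if_neg hz]
    ring

theorem inv_sub_jacobsonBlock {p : K[X]} (hp : p.Monic) (k : ℕ) :
    ((RatFunc.X : RatFunc K) • (1 : Matrix (Fin k × Fin p.natDegree) (Fin k × Fin p.natDegree)
      (RatFunc K)) - (jacobsonBlock p k).map RatFunc.C)⁻¹ = resolvent p k :=
  Matrix.inv_eq_right_inv (mul_resolvent hp k)

/-- Modulo polynomials, the resolvent is the rank one matrix `b (M b)ᵀ / pᵏ`, expanded in powers
of `p`. -/
theorem resolvent_sub_mem_range {p : K[X]} (hp : p.Monic) {k : ℕ}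
    (z w : Fin k × Fin p.natDegree) :
    resolvent p k z w - algebraMap K[X] (RatFunc K)
        ((X ^ (z.2 : ℕ) * p ^ (z.1 : ℕ)) * (horner p w.2 * p ^ (k - 1 - (w.1 : ℕ)))) /
      algebraMap K[X] (RatFunc K) p ^ k ∈ (algebraMap K[X] (RatFunc K)).range := by
  have hp' : algebraMap K[X] (RatFunc K) p ≠ 0 := RatFunc.algebraMap_ne_zero hp.ne_zero
  obtain ⟨⟨i, hi⟩, x⟩ := z
  obtain ⟨⟨c, hc⟩, y⟩ := w
  simp only [resolvent, Matrix.of_apply, resolventEntry]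
  by_cases h : c < i
  -- Below the block diagonal the resolvent vanishes and the rank one term has at least `k` factors
  -- `p` in its numerator, hence is itself a polynomial.
  · refine ⟨-(X ^ (x : ℕ) * horner p y * p ^ (i - c - 1)), ?_⟩
    rw [if_pos h, zero_sub, map_neg, neg_inj, eq_div_iff (pow_ne_zero _ hp'), ← map_pow, ← map_mul]
    congr 1
    have e : p ^ (i - c - 1) * p ^ k = p ^ i * p ^ (k - 1 - c) := by
      rw [← pow_add, ← pow_add]; congr 1; omega
    linear_combination X ^ (x : ℕ) * horner p y * e
  · have e : algebraMap K[X] (RatFunc K)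
        ((X ^ (x : ℕ) * p ^ i) * (horner p y * p ^ (k - 1 - c))) /
        algebraMap K[X] (RatFunc K) p ^ k = algebraMap K[X] (RatFunc K) (X ^ (x : ℕ) * horner p y) /
        algebraMap K[X] (RatFunc K) p ^ (c - i + 1) := by
      have e' : p ^ i * p ^ (k - 1 - c) * p ^ (c - i + 1) = p ^ k := by
        rw [← pow_add, ← pow_add]; congr 1; omega
      rw [div_eq_div_iff (pow_ne_zero _ hp') (pow_ne_zero _ hp'), ← map_pow, ← map_pow, ← map_mul,
        ← map_mul]
      congr 1
      linear_combination X ^ (x : ℕ) * horner p y * e'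
    rw [if_neg h, e, sub_sub_cancel_left]
    split_ifs
    · exact neg_mem ⟨_, rfl⟩
    · simp

/-! ### The strictly proper part of `h gᵀ / pᵏ` -/

theorem exists_eq_outputMatrix_sum {q : Type*} {p : K[X]} (hp : p.Monic) (k : ℕ) (h : q → K[X])
    (a : q) : ∃ u : K[X], h a = (∑ z : Fin k × Fin p.natDegree,
      C (outputMatrix p k h a z) * (X ^ (z.2 : ℕ) * p ^ (z.1 : ℕ))) + u * p ^ k := by
  refine ⟨(fun u => u /ₘ p)^[k] (h a), (sum_padicCoeff p (h a) k).trans ?_⟩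
  congr 1
  rw [Fintype.sum_prod_type, ← Fin.sum_univ_eq_sum_range (fun i => padicCoeff p (h a) i * p ^ i)]
  refine Finset.sum_congr rfl fun i _ => ?_
  rw [← congrFun (padicMatrix_mulVec hp h i) a, Matrix.mulVec, dotProduct, Finset.sum_mul]
  simp [outputMatrix, powerVector, mul_assoc]

theorem hankelM_mulVec (p : K[X]) (y : Fin p.natDegree) :
    ((hankelM p).map C *ᵥ powerVector p.natDegree) y = horner p y := by
  rw [Matrix.mulVec, dotProduct, horner,
    ← Fin.sum_univ_eq_sum_range (fun l => C (p.coeff (l + y + 1)) * X ^ l)]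
  simp [hankelM, powerVector, add_comm]

theorem exists_eq_inputMatrix_sum {t : Type*} {p : K[X]} (hp : p.Monic) (k : ℕ) (g : t → K[X])
    (b : t) : ∃ u : K[X], g b = (∑ w : Fin k × Fin p.natDegree,
      C (inputMatrix p k g w b) * (horner p w.2 * p ^ (k - 1 - (w.1 : ℕ)))) + u * p ^ k := by
  refine ⟨(fun u => u /ₘ p)^[k] (g b), (sum_padicCoeff p (g b) k).trans ?_⟩
  congr 1
  -- The blocks of `G` are stacked in decreasing order, so the expansion of `g` is summed in
  -- reverse.
  rw [Fintype.sum_prod_type, ← Finset.sum_range_reflect,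
    ← Fin.sum_univ_eq_sum_range (fun i => padicCoeff p (g b) (k - 1 - i) * p ^ (k - 1 - i))]
  refine Finset.sum_congr rfl fun i _ => ?_
  rw [← congrFun (padicMatrixM_mulVec hp g _) b, Matrix.map_mul, ← Matrix.mulVec_mulVec,
    Matrix.mulVec, dotProduct, Finset.sum_mul]
  simp only [hankelM_mulVec, inputMatrix, Matrix.of_apply, Matrix.transpose_apply,
    Matrix.map_apply, mul_assoc]

theorem transferMatrix_jacobsonBlock_apply {q t : Type*} {p : K[X]} (hp : p.Monic) (k : ℕ)
    (H : Matrix q (Fin k × Fin p.natDegree) K) (G : Matrix (Fin k × Fin p.natDegree) t K)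
    (a : q) (b : t) :
    transferMatrix H (jacobsonBlock p k) G a b =
      ∑ w, ∑ z, RatFunc.C (H a z) * (RatFunc.C (G w b) * resolvent p k z w) := by
  rw [transferMatrix, inv_sub_jacobsonBlock hp, Matrix.mul_apply]
  refine Finset.sum_congr rfl fun w _ => ?_
  rw [Matrix.mul_apply, Finset.sum_mul]
  refine Finset.sum_congr rfl fun z _ => ?_
  simp only [Matrix.map_apply]
  ring

theorem piMinus_eq_transferMatrix {q t : Type*} {p : K[X]} (hp : p.Monic) (k : ℕ) (h : q → K[X])
    (g : t → K[X]) (a : q) (b : t) :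
    piMinus (algebraMap K[X] (RatFunc K) (h a * g b) / algebraMap K[X] (RatFunc K) p ^ k) =
      transferMatrix (outputMatrix p k h) (jacobsonBlock p k) (inputMatrix p k g) a b := by
  have hp' : algebraMap K[X] (RatFunc K) p ≠ 0 := RatFunc.algebraMap_ne_zero hp.ne_zero
  obtain ⟨u, hu⟩ := exists_eq_outputMatrix_sum hp k h a
  obtain ⟨v, hv⟩ := exists_eq_inputMatrix_sum hp k g b
  set S := ∑ z : Fin k × Fin p.natDegree,
      C (outputMatrix p k h a z) * (X ^ (z.2 : ℕ) * p ^ (z.1 : ℕ)) with hS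
  set T := ∑ w : Fin k × Fin p.natDegree,
      C (inputMatrix p k g w b) * (horner p w.2 * p ^ (k - 1 - (w.1 : ℕ))) with hT
  rw [transferMatrix_jacobsonBlock_apply hp]
  have hmem : (∑ w, ∑ z, RatFunc.C (outputMatrix p k h a z) *
      (RatFunc.C (inputMatrix p k g w b) * resolvent p k z w)) -
      algebraMap K[X] (RatFunc K) (S * T) / algebraMap K[X] (RatFunc K) p ^ k ∈
      (algebraMap K[X] (RatFunc K)).range := by
    rw [hS, hT, Finset.sum_mul_sum, Finset.sum_comm, map_sum, Finset.sum_div,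
      ← Finset.sum_sub_distrib]
    refine sum_mem fun z _ => ?_
    rw [map_sum, Finset.sum_div, ← Finset.sum_sub_distrib]
    refine sum_mem fun w _ => ?_
    have hC : ∀ c : K, RatFunc.C c ∈ (algebraMap K[X] (RatFunc K)).range :=
      fun c => ⟨C c, RatFunc.algebraMap_C c⟩
    have := mul_mem (hC (outputMatrix p k h a z)) (mul_mem (hC (inputMatrix p k g w b))
      (resolvent_sub_mem_range hp z w))
    convert this using 1
    rw [mul_mul_mul_comm, map_mul, map_mul _ (C _), RatFunc.algebraMap_C, RatFunc.algebraMap_C]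
    ring
  obtain ⟨y, hy⟩ := hmem
  -- `S` and `T` are `h a` and `g b` truncated modulo `p ^ k`. Here `u * g b + S * v` is the
  -- truncation error of the product divided by `p ^ k`, and `y` is the polynomial by which the
  -- transfer matrix entry exceeds `S * T / p ^ k`.
  refine (piMinus_unique _ _ (u * g b + S * v - y) ?_ ?_).symm
  · refine isStrictlyProper_sum _ _ fun w _ => isStrictlyProper_sum _ _ fun z _ => ?_
    exact ((isStrictlyProper_resolventEntry z.2.2 w.2.2).C_mul _).C_mul _
  · have e : h a * g b = S * T + (u * g b + S * v) * p ^ k := by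
      linear_combination g b * hu + S * hv
    rw [map_sub, hy, e, map_add, map_mul _ _ (p ^ k), map_pow]
    field_simp
    ring

/-! ### Minimality -/

/-- The characteristic polynomial of `F` is a common denominator of `H (sI - F)⁻¹ G`. -/
theorem charpoly_mul_transferMatrix_mem_range {q t ι : Type*} [Fintype ι] [DecidableEq ι]
    (H : Matrix q ι K) (F : Matrix ι ι K) (G : Matrix ι t K) (a : q) (b : t) :
    algebraMap K[X] (RatFunc K) F.charpoly * transferMatrix H F G a b ∈
      (algebraMap K[X] (RatFunc K)).range := by
  have hF : (RatFunc.X : RatFunc K) • (1 : Matrix ι ι (RatFunc K)) - F.map RatFunc.C =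
      (algebraMap K[X] (RatFunc K)).mapMatrix F.charmatrix := by
    ext i j
    simp [Matrix.charmatrix_apply, Matrix.one_apply, Matrix.diagonal_apply,
      apply_ite (algebraMap K[X] (RatFunc K))]
  have hdet : algebraMap K[X] (RatFunc K) F.charpoly ≠ 0 :=
    RatFunc.algebraMap_ne_zero F.charpoly_monic.ne_zero
  have hinv : algebraMap K[X] (RatFunc K) F.charpoly •
      ((RatFunc.X : RatFunc K) • (1 : Matrix ι ι (RatFunc K)) - F.map RatFunc.C)⁻¹ =
      (algebraMap K[X] (RatFunc K)).mapMatrix F.charmatrix.adjugate := by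
    rw [hF, Matrix.inv_def, ← RingHom.map_det, ← RingHom.map_adjugate, Ring.inverse_eq_inv',
      smul_smul, Matrix.charpoly, mul_inv_cancel₀ (by exact hdet), one_smul]
  refine ⟨(H.map C * F.charmatrix.adjugate * G.map C) a b, ?_⟩
  have : algebraMap K[X] (RatFunc K) F.charpoly • transferMatrix H F G =
      (H.map C * F.charmatrix.adjugate * G.map C).map (algebraMap K[X] (RatFunc K)) := by
    rw [transferMatrix, ← Matrix.smul_mul, ← Matrix.mul_smul, hinv, Matrix.map_mul, Matrix.map_mul]
    simp only [Matrix.map_map, RingHom.mapMatrix_apply]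
    congr 2
  exact (congrFun (congrFun this a) b).symm

/-- Otherwise the `1 × 1` matrix `p` would be a non-unimodular common right divisor; `k ≠ 0` ensures
that it divides `p ^ k`. -/
theorem exists_not_dvd_of_isRightCoprime {q : Type*} {p : K[X]} (hp : Irreducible p) {k : ℕ}
    (hk : k ≠ 0) {h : q → K[X]} (hc : IsRightCoprime (Matrix.replicateCol Unit h)
      (Matrix.of fun _ _ : Unit => p ^ k)) : ∃ a, ¬ p ∣ h a := by
  by_contra! hall
  choose h' hh' using hall
  have := hc (Matrix.of fun _ _ => p) (Matrix.of fun _ _ => p ^ (k - 1)) (Matrix.replicateCol Unit h')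
    (by ext1 a u; simp [Matrix.mul_apply, hh' a, mul_comm])
    (by ext1 u v; simp [Matrix.mul_apply, ← pow_succ, Nat.sub_add_cancel (Nat.pos_of_ne_zero hk)])
  rw [Matrix.isUnit_iff_isUnit_det, Matrix.det_unique] at this
  exact hp.not_isUnit this

theorem exists_not_dvd_of_isLeftCoprime {t : Type*} {p : K[X]} (hp : Irreducible p) {k : ℕ}
    (hk : k ≠ 0) {g : t → K[X]} (hc : IsLeftCoprime (Matrix.of fun _ _ : Unit => p ^ k)
      (Matrix.replicateRow Unit g)) : ∃ b, ¬ p ∣ g b := by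
  by_contra! hall
  choose g' hg' using hall
  have := hc (Matrix.of fun _ _ => p) (Matrix.of fun _ _ => p ^ (k - 1)) (Matrix.replicateRow Unit g')
    (by ext1 u v; simp [Matrix.mul_apply, ← pow_succ', Nat.sub_add_cancel (Nat.pos_of_ne_zero hk)])
    (by ext1 u b; simp [Matrix.mul_apply, hg' b])
  rw [Matrix.isUnit_iff_isUnit_det, Matrix.det_unique] at this
  exact hp.not_isUnit this

/-- Any realization of the strictly proper part of `h g / pᵏ`, with `h` and `g` prime to `p`, has
dimension at least `deg pᵏ`. -/
theorem natDegree_pow_le_of_isRealization {q t : Type*} {p : K[X]} (hp : Irreducible p) (k : ℕ)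
    {h g : K[X]} (hh : ¬ p ∣ h) (hg : ¬ p ∣ g) {T : Matrix q t (RatFunc K)} {a : q} {b : t}
    (hT : T a b = piMinus (algebraMap K[X] (RatFunc K) (h * g) / algebraMap K[X] (RatFunc K) p ^ k))
    {m : ℕ} {H : Matrix q (Fin m) K} {F : Matrix (Fin m) (Fin m) K} {G : Matrix (Fin m) t K}
    (hr : IsRealization T H F G) : k * p.natDegree ≤ m := by
  have hp' : algebraMap K[X] (RatFunc K) p ≠ 0 := RatFunc.algebraMap_ne_zero hp.ne_zero
  obtain ⟨-, y, hy⟩ := piMinus_spec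
    (algebraMap K[X] (RatFunc K) (h * g) / algebraMap K[X] (RatFunc K) p ^ k)
  obtain ⟨r, hr'⟩ := charpoly_mul_transferMatrix_mem_range H F G a b
  rw [← hr, hT] at hr'
  -- Since `π₋` changes `h * g / p ^ k` only by the polynomial `y`, the characteristic polynomial
  -- clears the denominator `p ^ k` as well.
  have e : F.charpoly * (h * g) = p ^ k * (r + F.charpoly * y) := by
    apply RatFunc.algebraMap_injective K
    rw [div_eq_iff (pow_ne_zero _ hp')] at hy
    rw [map_mul, hy, map_mul _ (p ^ k), map_add, map_mul _ _ y, map_pow, hr']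
    ring
  have hcop : IsCoprime (p ^ k) (h * g) :=
    (((hp.coprime_iff_not_dvd).2 hh).mul_right ((hp.coprime_iff_not_dvd).2 hg)).pow_left
  have hdvd : p ^ k ∣ F.charpoly := hcop.dvd_of_dvd_mul_right ⟨_, e⟩
  have := natDegree_le_of_dvd hdvd F.charpoly_monic.ne_zero
  rwa [natDegree_pow, Matrix.charpoly_natDegree_eq_dim, Fintype.card_fin] at this

end JacobsonRealization

theorem theorem4p1 {K : Type*} [Field K] {q t : ℕ} (p : K[X]) (hmonic : p.Monic)
    (hirr : Irreducible p) (k : ℕ) (h : Fin q → K[X]) (g : Fin t → K[X])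
    (W : Matrix (Fin q) (Fin t) (RatFunc K))
    (hW : IsCoprimeFactorization W (Matrix.replicateCol Unit h)
      (Matrix.of fun _ _ : Unit => p ^ k) (Matrix.replicateRow Unit g)) :
    W.map piMinus =
        transferMatrix (outputMatrix p k h) (jacobsonBlock p k) (inputMatrix p k g) ∧
      IsMinimalRealization (W.map piMinus)
        (outputMatrix p k h) (jacobsonBlock p k) (inputMatrix p k g) := by
  have hWab : ∀ a b, W a b =
      algebraMap K[X] (RatFunc K) (h a * g b) / algebraMap K[X] (RatFunc K) p ^ k := by
    intro a b
    rw [hW.eq, Matrix.inv_subsingleton]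
    simp [Matrix.mul_apply, Ring.inverse_eq_inv', div_eq_mul_inv, mul_right_comm]
  have hreal : W.map piMinus =
      transferMatrix (outputMatrix p k h) (jacobsonBlock p k) (inputMatrix p k g) := by
    ext a b
    rw [Matrix.map_apply, hWab, piMinus_eq_transferMatrix hmonic]
  refine ⟨hreal, hreal, fun m H' F' G' hr => ?_⟩
  rw [Fintype.card_prod, Fintype.card_fin, Fintype.card_fin]
  -- For `k = 0` coprimality says nothing about `h` and `g`, but the dimension is zero and the bound
  -- is trivial.
  rcases eq_or_ne k 0 with rfl | hk
  · simp
  · obtain ⟨a, ha⟩ := exists_not_dvd_of_isRightCoprime hirr hk hW.right_coprime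
    obtain ⟨b, hb⟩ := exists_not_dvd_of_isLeftCoprime hirr hk hW.left_coprime
    exact natDegree_pow_le_of_isRealization hirr k ha hb
      (by rw [Matrix.map_apply, hWab]) hr
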